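/- For a real function $f$ on the subsets of a finite set $N$ write $f(A,B)=f(A)+f(B)-f(A\cup B)$, $f(A,B\,|\,C)=f(A\cup C)+f(B\cup C)-f(A\cup B\cup C)-f(C)$ and $f[A,B,C,D]=-f(A,B)+f(A,B\,|\,C)+f(A,B\,|\,D)+f(C,D)$ (the Ingleton expression). A polymatroid on $N$ is such an $f$ with $f(\emptyset)=0$ that satisfies all Shannon inequalities: $f(A\cup B)-f(B)\ge 0$, $f(A,B)\ge 0$ and $f(A,B\,|\,C)\ge 0$ for all $A,B,C\subseteq N$. It is representable over a field $\mathbb F$ if there are subspaces $V_i$ $(i\in N)$ of a finite-dimensional $\mathbb F$-vector space with $f(I)=\dim\sum_{i\in I}V_i$ for all $I\subseteq N$; it is linear if, for some field $\mathbb F$, it lies in the closure of the set of non-negative real multiples of $\mathbb F$-representable polymatroids. Let $N=\{a,b,c,d,z\}$ and $n\ge 1$. An $n$-copy of a function $f$ on the subsets of $N$ is a polymatroid $f^*$ on $N^*=\{a,b,z\}\cup\{c_i,d_i:1\le i\le n\}$ such that $f^*$ agrees with $f$ on the subsets of $\{a,b,z\}$; for each $i$, $f^*$ restricted to $\{a,b,c_i,d_i\}$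 agrees with $f$ restricted to $\{a,b,c,d\}$ under $c_i\leftrightarrow c$, $d_i\leftrightarrow d$; and the $n+1$ sets $\{c_1,d_1\},\dots,\{c_n,d_n\},\{z\}$ are completely conditionally independent over $\{a,b\}$, that is, $f^*(Y,Y'\,|\,\{a,b\})=0$ whenever $Y$ and $Y'$ are unions of two disjoint subfamilies of these sets. Call $f$ central if $f[abcd]$, $f[acbd]$, $f[adbc]$, $f[bcad]$, $f[bdac]$ and $f[cdab]$ are all non-negative (on singletons). These conditions involve only the values of $f$ at the empty set and at the $19$ non-empty sets $A$ with $A\subseteq\{a,b,c,d\}$ or $A\subseteq\{a,b,z\}$. With the convention $x(\emptyset)=0$, let $\mathcal Q^*_n\subseteq\mathbb R^{19}$ be the set of vectors $x$, indexed by these sets, that have an $n$-copy. (1) If $f$ is a polymatroid on $N$ whose restriction to $\{a,b,c,d\}$ is linear, then $f$ has an $n$-copy for every $n\ge 1$. (2) Every central polymatroid on $N$ has an $n$-copy for every $n\ge 1$. (3) Consequently the central part yields no new inequalities. For every $n\ge1$ the set of central $x\in\mathcal Q^*_n$ is exactly the set of the restrictions, to the $19$ sets above, of the central polymatroids on $N$.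 Every homogeneous linear inequality in the values $f(A)$, $A\subseteq N$, that is valid for all central polymatroids on $N$ with an $n$-copy is valid for all central polymatroids on $N$; and every homogeneous linear inequality valid for all central $x\in\mathcal Q^*_n$ is valid for the restrictions of all central polymatroids on $N$. In other words, each of these inequalities is implied by the Shannon inequalities and the six Ingleton inequalities. -/

import Mathlib

universe u

noncomputable section

namespace CopyLemma

section General

variable {N : Type*} [DecidableEq N]

/-- Conditional entropy `f(A|B)`. -/
def condEnt (f : Finset N → ℝ) (A B : Finset N) : ℝ :=
  f (A ∪ B) - f B

/-- Mutual information `f(A,B)`. -/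
def mutInfo (f : Finset N → ℝ) (A B : Finset N) : ℝ :=
  f A + f B - f (A ∪ B)

/-- Conditional mutual information `f(A,B|C)`. -/
def condMutInfo (f : Finset N → ℝ) (A B C : Finset N) : ℝ :=
  f (A ∪ C) + f (B ∪ C) - f (A ∪ B ∪ C) - f C

/-- The Ingleton expression `f[A,B,C,D]`. -/
def ingletonExpr (f : Finset N → ℝ) (A B C D : Finset N) : ℝ :=
  -mutInfo f A B + condMutInfo f A B C + condMutInfo f A B D + mutInfo f C D

/-- A (real-valued) polymatroid on `N`: a function on the subsets of `N`, normalized by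
`f ∅ = 0`, that satisfies all Shannon inequalities. -/
structure IsPolymatroid (f : Finset N → ℝ) : Prop where
  empty : f ∅ = 0
  condEnt_nonneg : ∀ A B, 0 ≤ condEnt f A B
  mutInfo_nonneg : ∀ A B, 0 ≤ mutInfo f A B
  condMutInfo_nonneg : ∀ A B C, 0 ≤ condMutInfo f A B C

/-- The restriction of `f` to the subsets of `S`. -/
def restrict (f : Finset N → ℝ) (S : Finset N) : Finset {x // x ∈ S} → ℝ :=
  fun A => f (A.map (Function.Embedding.subtype (fun x => x ∈ S)))

/-- The sets `Y i` are completely conditionally independent over `X` in `f`: the unions over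
any two disjoint sets of indices are conditionally independent over `X`. -/
def CompletelyCondIndep {ι : Type*} (f : Finset N → ℝ) (Y : ι → Finset N) (X : Finset N) :
    Prop :=
  ∀ I J : Finset ι, Disjoint I J → condMutInfo f (I.biUnion Y) (J.biUnion Y) X = 0

end General

section Linear


/-- `f` is representable over the field `F`: its values are the dimensions of the spans of the
members of a finite arrangement of subspaces of a finite-dimensional `F`-vector space. -/
def IsRepresentable {N : Type*} (F : Type u) [Field F] (f : Finset N → ℝ) : Prop :=
  ∃ (V : Type u) (_ : AddCommGroup V) (_ : Module F V) (_ : FiniteDimensional F V)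
    (W : N → Submodule F V),
    ∀ I : Finset N, f I = (Module.finrank F (⨆ i ∈ I, W i : Submodule F V) : ℝ)

/-- `f` is `F`-linear: it is in the closure of the non-negative multiples of
`F`-representable polymatroids. -/
def IsLinearOver {N : Type*} (F : Type u) [Field F] (f : Finset N → ℝ) : Prop :=
  f ∈ closure {g : Finset N → ℝ | ∃ (t : ℝ) (h : Finset N → ℝ),
    0 ≤ t ∧ IsRepresentable F h ∧ g = t • h}

/-- `f` is linear: it is `F`-linear for some field `F`. -/
def IsLinear {N : Type*} (f : Finset N → ℝ) : Prop :=
  ∃ (F : Type u) (_ : Field F), IsLinearOver F f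

end Linear

/-- The five-element base set `abcdz`. -/
inductive Base : Type
  | a | b | c | d | z
  deriving DecidableEq

/-- The base set `abz ∪ {c_i, d_i : i < n}`. -/
inductive CopyBase (n : ℕ) : Type
  | a | b | z
  | c (i : Fin n)
  | d (i : Fin n)
  deriving DecidableEq

/-- The subset `abcd`. -/
def abcd : Finset Base := {Base.a, Base.b, Base.c, Base.d}

/-- The subset `abz`. -/
def abz : Finset Base := {Base.a, Base.b, Base.z}

/-- The correspondence `c ↔ c_i`, `d ↔ d_i`, fixing `a`, `b` and `z`. -/
def copyMap {n : ℕ} (i : Fin n) : Base → CopyBase n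
  | Base.a => CopyBase.a
  | Base.b => CopyBase.b
  | Base.c => CopyBase.c i
  | Base.d => CopyBase.d i
  | Base.z => CopyBase.z

/-- The `n + 1` blocks `{c_i, d_i}` and `{z}`. -/
def block {n : ℕ} : Option (Fin n) → Finset (CopyBase n)
  | none => {CopyBase.z}
  | some i => {CopyBase.c i, CopyBase.d i}

/-- `g` is an `n`-copy of `f` (for `n ≥ 1`). On subsets of `abz` the map `copyMap i` does not
depend on `i`, so `restr_abz` says that `g` and `f` agree on the subsets of `abz`. -/
structure IsNCopy (n : ℕ) (f : Finset Base → ℝ) (g : Finset (CopyBase n) → ℝ) : Prop where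
  polymatroid : IsPolymatroid g
  restr_abz : ∀ (i : Fin n) (A : Finset Base), A ⊆ abz → g (A.image (copyMap i)) = f A
  restr_abcd : ∀ (i : Fin n) (A : Finset Base), A ⊆ abcd → g (A.image (copyMap i)) = f A
  indep : CompletelyCondIndep g block {CopyBase.a, CopyBase.b}

/-- `f` has an `n`-copy. -/
def HasNCopy (n : ℕ) (f : Finset Base → ℝ) : Prop :=
  ∃ g : Finset (CopyBase n) → ℝ, IsNCopy n f g

/-- The six Ingleton values of `f` on `abcd` are non-negative. -/
def IsCentral (f : Finset Base → ℝ) : Prop :=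
  0 ≤ ingletonExpr f {Base.a} {Base.b} {Base.c} {Base.d} ∧
  0 ≤ ingletonExpr f {Base.a} {Base.c} {Base.b} {Base.d} ∧
  0 ≤ ingletonExpr f {Base.a} {Base.d} {Base.b} {Base.c} ∧
  0 ≤ ingletonExpr f {Base.b} {Base.c} {Base.a} {Base.d} ∧
  0 ≤ ingletonExpr f {Base.b} {Base.d} {Base.a} {Base.c} ∧
  0 ≤ ingletonExpr f {Base.c} {Base.d} {Base.a} {Base.b}

/-- The cone of the polymatroids on `abcdz` that have an `n`-copy. -/
def copyCone (n : ℕ) : Set (Finset Base → ℝ) :=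
  {f | IsPolymatroid f ∧ HasNCopy n f}

/-- The 19 non-empty subsets of `abcd` or of `abz`. -/
abbrev Coord : Type :=
  {A : Finset Base // A.Nonempty ∧ (A ⊆ abcd ∨ A ⊆ abz)}

/-- The part of `f` indexed by the subsets of `abcd` and `abz`. -/
def proj (f : Finset Base → ℝ) : Coord → ℝ :=
  fun A => f A.1

open Classical in
/-- A vector indexed by `Coord` as a function on all subsets of the base set (extended by `0`;
the values outside `Coord`, except `0` at the empty set, play no role below). -/
def extend (x : Coord → ℝ) : Finset Base → ℝ :=
  fun A => if h : A.Nonempty ∧ (A ⊆ abcd ∨ A ⊆ abz) then x ⟨A, h⟩ else 0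

/-- The cone `Q*` in `ℝ^19`: the vectors for which the `n`-copy conditions are solvable. -/
def QStar (n : ℕ) : Set (Coord → ℝ) :=
  {x | HasNCopy n (extend x)}

end CopyLemma

end

/-! The proof adjoins a common information `w` of `a` and `b`: an element with `q(aw) = q(a)`,
`q(bw) = q(b)` and `q(w)` equal to the mutual information of `a` and `b`. Given Shannon, five of the
six Ingleton inequalities suffice for a polymatroid on four sets to extend by such a `w`
(`IsPolymatroid.exists_commonInfo`). Only the values at `w`, `cw`, `dw`, `cdw` are new, because `w`
adds nothing to a set containing `a` or `b`. This leaves a small system of linear inequalities,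
solved in `exists_commonInfo_values`.

The gain is modularity. On the lattice `∅, w, aw, bw, abw` the rank is an additive function `r`,
whereas on `∅, a, b, ab` it is only submodular. Polymatroids `q_i` that agree with a modular `r` on
a lattice `L` can be glued freely by `g(I) = min over T in L of (∑ q_i(I ∪ T) - (k - 1) r(T))`,
where `k` is their number. Modularity makes the negative terms cancel in the submodular inequality
(`isPolymatroid_glue`).

Gluing `n` parts `abcdw` and one part `abzw` yields the `n`-copy. A set living in one part keeps its
rank (`glue_eq_of_subset`), and above `ab` the rank is a sum over parts (`glue_eq_sum`), which is
the conditional independence.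

Linear polymatroids satisfy Ingleton, so (1) reduces to (2). For (3), a copy pulled back along `c ↦
c_i`, `d ↦ d_i` is a polymatroid on the original base set. -/

namespace CopyLemma

/-! ### The linear system for a common information -/

/-- Values `x`, `y`, `u` of an extension by a common information `w` of `a` and `b` at `cw`, `dw`,
`cdw`. The variables stand for the values of a polymatroid on four elements. The pair `x`, `y` is the
greatest one subject to the upper bounds on `x`, `y`, `x - y` and `y - x`, and `u` is then least. -/
theorem exists_commonInfo_values {a b c d ab ac ad bc bd cd abc abd acd bcd abcd m : ℝ}
    (hm : m = a + b - ab)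
    (s_ab : ab ≤ a + b) (s_ac : ac ≤ a + c) (s_ad : ad ≤ a + d) (s_bc : bc ≤ b + c)
    (s_bd : bd ≤ b + d) (s_cd : cd ≤ c + d)
    (s_ab_c : abc + c ≤ ac + bc) (s_ab_d : abd + d ≤ ad + bd) (s_ab_cd : abcd + cd ≤ acd + bcd)
    (s_ac_b : abc + b ≤ ab + bc) (s_ac_d : acd + d ≤ ad + cd) (s_ac_bd : abcd + bd ≤ abd + bcd)
    (s_ad_b : abd + b ≤ ab + bd) (s_ad_c : acd + c ≤ ac + cd) (s_ad_bc : abcd + bc ≤ abc + bcd)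
    (s_bc_a : abc + a ≤ ab + ac) (s_bc_d : bcd + d ≤ bd + cd) (s_bc_ad : abcd + ad ≤ abd + acd)
    (s_bd_a : abd + a ≤ ab + ad) (s_bd_c : bcd + c ≤ bc + cd) (s_bd_ac : abcd + ac ≤ abc + acd)
    (s_cd_a : acd + a ≤ ac + ad) (s_cd_b : bcd + b ≤ bc + bd)
    (ing : cd + m ≤ (ac + bc - abc) + (ad + bd - abd))
    (ing_ac : a + c - ac ≤ (ab + bc - abc - b) + (ad + cd - acd - d) + (b + d - bd))
    (ing_ad : a + d - ad ≤ (ab + bd - abd - b) + (ac + cd - acd - c) + (b + c - bc))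
    (ing_bc : b + c - bc ≤ (ab + ac - abc - a) + (bd + cd - bcd - d) + (a + d - ad))
    (ing_bd : b + d - bd ≤ (ab + ad - abd - a) + (bc + cd - bcd - c) + (a + c - ac)) :
    ∃ x y u : ℝ, c ≤ x ∧ d ≤ y ∧ cd ≤ u ∧
      x + abc ≤ ac + bc ∧ y + abd ≤ ad + bd ∧ u + abcd ≤ acd + bcd ∧
      x ≤ c + m ∧ y ≤ d + m ∧ u + m ≤ x + y ∧ u + d ≤ cd + y ∧ u + c ≤ cd + x ∧
      ac + m ≤ x + a ∧ bc + m ≤ x + b ∧ ad + m ≤ y + a ∧ bd + m ≤ y + b ∧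
      acd + y ≤ u + ad ∧ bcd + y ≤ u + bd ∧ acd + x ≤ u + ac ∧ bcd + x ≤ u + bc := by
  obtain ⟨k, k1, k2, le_k⟩ : ∃ k, k ≤ ac + bc - abc ∧ k ≤ c + m ∧
      ∀ t, t ≤ ac + bc - abc → t ≤ c + m → t ≤ k :=
    ⟨_, min_le_left _ _, min_le_right _ _, fun t => le_min⟩
  obtain ⟨l, l1, l2, le_l⟩ : ∃ l, l ≤ ad + bd - abd ∧ l ≤ d + m ∧
      ∀ t, t ≤ ad + bd - abd → t ≤ d + m → t ≤ l :=
    ⟨_, min_le_left _ _, min_le_right _ _, fun t => le_min⟩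
  -- `p` bounds `x - y`: eliminate `u` between a lower bound such as `acd + x ≤ u + ac` and the
  -- upper bound `u + d ≤ cd + y`. Likewise `q` bounds `y - x`.
  obtain ⟨p, p1, p2, le_p⟩ : ∃ p, p ≤ cd - d - (acd - ac) ∧ p ≤ cd - d - (bcd - bc) ∧
      ∀ t, t ≤ cd - d - (acd - ac) → t ≤ cd - d - (bcd - bc) → t ≤ p :=
    ⟨_, min_le_left _ _, min_le_right _ _, fun t => le_min⟩
  obtain ⟨q, q1, q2, le_q⟩ : ∃ q, q ≤ cd - c - (acd - ad) ∧ q ≤ cd - c - (bcd - bd) ∧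
      ∀ t, t ≤ cd - c - (acd - ad) → t ≤ cd - c - (bcd - bd) → t ≤ q :=
    ⟨_, min_le_left _ _, min_le_right _ _, fun t => le_min⟩
  have le_kq : ∀ t, t ≤ ac + bc - abc + (cd - c - (acd - ad)) →
      t ≤ ac + bc - abc + (cd - c - (bcd - bd)) → t ≤ c + m + (cd - c - (acd - ad)) →
      t ≤ c + m + (cd - c - (bcd - bd)) → t ≤ k + q := by
    intro t h1 h2 h3 h4
    have := le_q (t - k) (by linarith [le_k (t - (cd - c - (acd - ad))) (by linarith) (by linarith)])
      (by linarith [le_k (t - (cd - c - (bcd - bd))) (by linarith) (by linarith)])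
    linarith
  have le_lp : ∀ t, t ≤ ad + bd - abd + (cd - d - (acd - ac)) →
      t ≤ ad + bd - abd + (cd - d - (bcd - bc)) → t ≤ d + m + (cd - d - (acd - ac)) →
      t ≤ d + m + (cd - d - (bcd - bc)) → t ≤ l + p := by
    intro t h1 h2 h3 h4
    have := le_p (t - l) (by linarith [le_l (t - (cd - d - (acd - ac))) (by linarith) (by linarith)])
      (by linarith [le_l (t - (cd - d - (bcd - bc))) (by linarith) (by linarith)])
    linarith
  have hpq : 0 ≤ p + q := by
    have := le_p (-q) (by linarith [le_q (-(cd - d - (acd - ac))) (by linarith) (by linarith)])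
      (by linarith [le_q (-(cd - d - (bcd - bc))) (by linarith) (by linarith)])
    linarith
  -- Needed because `u` must lie between `cd` and `x + y - m`. The critical case is the inequality
  -- `ing`.
  have hkl : cd + m ≤ k + l := by
    have := le_k (cd + m - l) (by linarith [le_l (cd + m - (ac + bc - abc)) (by linarith) (by linarith)])
      (by linarith [le_l (cd - c) (by linarith) (by linarith)])
    linarith
  -- Shannon inequalities suffice here: each bound in `k` is at least half of what either bound in
  -- `q` requires.
  have hkkq : cd + m ≤ k + (k + q) := by
    have h1 := le_k ((c + (acd - ad) + m) / 2) (by linarith) (by linarith)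
    have h2 := le_k ((c + (bcd - bd) + m) / 2) (by linarith) (by linarith)
    have := le_q (cd + m - k - k) (by linarith) (by linarith)
    linarith
  have hllp : cd + m ≤ l + (l + p) := by
    have h1 := le_l ((d + (acd - ac) + m) / 2) (by linarith) (by linarith)
    have h2 := le_l ((d + (bcd - bc) + m) / 2) (by linarith) (by linarith)
    have := le_p (cd + m - l - l) (by linarith) (by linarith)
    linarith
  obtain ⟨x, x1, x2, hx⟩ : ∃ x, x ≤ k ∧ x ≤ l + p ∧ (x = k ∨ x = l + p) :=
    ⟨_, min_le_left _ _, min_le_right _ _, min_choice _ _⟩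
  obtain ⟨y, y1, y2, hy⟩ : ∃ y, y ≤ l ∧ y ≤ k + q ∧ (y = l ∨ y = k + q) :=
    ⟨_, min_le_left _ _, min_le_right _ _, min_choice _ _⟩
  have le_x : ∀ t, t ≤ k → t ≤ l + p → t ≤ x := by
    rintro t h h'
    rcases hx with rfl | rfl <;> assumption
  have le_y : ∀ t, t ≤ l → t ≤ k + q → t ≤ y := by
    rintro t h h'
    rcases hy with rfl | rfl <;> assumption
  -- If `y = k + q`, then `x ≤ k = y - q`, and `0 ≤ p + q` finishes; the next line is symmetric.
  have hxyp : x - y ≤ p := by rcases hy with h | h <;> linarith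
  have hyxq : y - x ≤ q := by rcases hx with h | h <;> linarith
  have hxy : cd + m ≤ x + y := by
    rcases hx with h | h <;> rcases hy with h' | h' <;> linarith
  have x3 := le_x c (le_k _ (by linarith) (by linarith))
    (le_lp _ (by linarith) (by linarith) (by linarith) (by linarith))
  have y3 := le_y d (le_l _ (by linarith) (by linarith))
    (le_kq _ (by linarith) (by linarith) (by linarith) (by linarith))
  -- The other four Ingleton inequalities enter in this and the next three bounds, one in each:
  -- `ing_bd`, `ing_ad`, `ing_bc`, `ing_ac`.
  have x4 := le_x (ac + m - a) (le_k _ (by linarith) (by linarith))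
    (le_lp _ (by linarith) (by linarith) (by linarith) (by linarith))
  have x5 := le_x (bc + m - b) (le_k _ (by linarith) (by linarith))
    (le_lp _ (by linarith) (by linarith) (by linarith) (by linarith))
  have y4 := le_y (ad + m - a) (le_l _ (by linarith) (by linarith))
    (le_kq _ (by linarith) (by linarith) (by linarith) (by linarith))
  have y5 := le_y (bd + m - b) (le_l _ (by linarith) (by linarith))
    (le_kq _ (by linarith) (by linarith) (by linarith) (by linarith))
  obtain ⟨u, u1, u2, u3, u4, u5, hu⟩ : ∃ u, cd ≤ u ∧ acd - ad + y ≤ u ∧ bcd - bd + y ≤ u ∧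
      acd - ac + x ≤ u ∧ bcd - bc + x ≤ u ∧ ∀ t, cd ≤ t → acd - ad + y ≤ t → bcd - bd + y ≤ t →
      acd - ac + x ≤ t → bcd - bc + x ≤ t → u ≤ t :=
    ⟨max cd (max (max (acd - ad + y) (bcd - bd + y)) (max (acd - ac + x) (bcd - bc + x))),
      by simp, by simp, by simp, by simp, by simp, by simp +contextual⟩
  have u6 := hu (acd + bcd - abcd) (by linarith) (by linarith) (by linarith) (by linarith)
    (by linarith)
  have u7 := hu (x + y - m) (by linarith) (by linarith) (by linarith) (by linarith) (by linarith)
  have u8 := hu (cd + y - d) (by linarith) (by linarith) (by linarith) (by linarith) (by linarith)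
  have u9 := hu (cd + x - c) (by linarith) (by linarith) (by linarith) (by linarith) (by linarith)
  refine ⟨x, y, u, ?_⟩
  refine ⟨?_, ?_, ?_, ?_, ?_, ?_, ?_, ?_, ?_, ?_, ?_, ?_, ?_, ?_, ?_, ?_, ?_, ?_, ?_⟩ <;> linarith

/-! ### Equivalent forms of the polymatroid axioms, and pullbacks -/

section Polymatroid

variable {N M : Type*} [DecidableEq N] [DecidableEq M]

theorem IsPolymatroid.mono {f : Finset N → ℝ} (hf : IsPolymatroid f) {A B : Finset N}
    (h : A ⊆ B) : f A ≤ f B := by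
  have := hf.condEnt_nonneg B A
  rw [condEnt, Finset.union_eq_left.2 h] at this
  linarith

theorem IsPolymatroid.submod {f : Finset N → ℝ} (hf : IsPolymatroid f) (A B : Finset N) :
    f (A ∪ B) + f (A ∩ B) ≤ f A + f B := by
  have := hf.condMutInfo_nonneg A B (A ∩ B)
  rw [condMutInfo, Finset.union_eq_left.2 Finset.inter_subset_left,
    Finset.union_eq_left.2 Finset.inter_subset_right,
    Finset.union_eq_left.2 (Finset.inter_subset_left.trans Finset.subset_union_left)] at this
  linarith

theorem IsPolymatroid.of_mono_submod {f : Finset N → ℝ} (h0 : f ∅ = 0)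
    (hm : ∀ A B, A ⊆ B → f A ≤ f B)
    (hs : ∀ A B, f (A ∪ B) + f (A ∩ B) ≤ f A + f B) : IsPolymatroid f where
  empty := h0
  condEnt_nonneg A B := sub_nonneg.2 (hm _ _ Finset.subset_union_right)
  mutInfo_nonneg A B := by
    have h1 := hs A B
    have h2 := hm ∅ (A ∩ B) (Finset.empty_subset _)
    rw [mutInfo]
    linarith
  condMutInfo_nonneg A B C := by
    have h1 := hs (A ∪ C) (B ∪ C)
    have h2 := hm C ((A ∪ C) ∩ (B ∪ C))
      (Finset.subset_inter Finset.subset_union_right Finset.subset_union_right)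
    rw [show A ∪ C ∪ (B ∪ C) = A ∪ B ∪ C by grind] at h1
    rw [condMutInfo]
    linarith

/-- The polymatroid axioms follow from their elemental instances. -/
theorem IsPolymatroid.of_insert {f : Finset N → ℝ} (h0 : f ∅ = 0)
    (hm : ∀ K i, f K ≤ f (insert i K))
    (hs : ∀ K i j, i ≠ j → i ∉ K → j ∉ K →
      f (insert i (insert j K)) + f K ≤ f (insert i K) + f (insert j K)) : IsPolymatroid f := by
  have mono : ∀ A B, A ⊆ B → f A ≤ f B := by
    intro A B h
    rw [← Finset.union_eq_right.2 h]
    clear h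
    induction B using Finset.induction_on with
    | empty => simp
    | insert i B _ ih =>
      rw [Finset.union_insert]
      exact ih.trans (hm _ _)
  have step : ∀ (S K : Finset N) (i : N),
      f (insert i (K ∪ S)) + f K ≤ f (insert i K) + f (K ∪ S) := by
    intro S K i
    induction S using Finset.induction_on with
    | empty => simp
    | insert s S _ ih =>
      rw [Finset.union_insert]
      by_cases hs' : s ∈ K ∪ S
      · rwa [Finset.insert_eq_of_mem hs']
      by_cases hi : i ∈ insert s (K ∪ S)
      · rw [Finset.insert_eq_of_mem hi]
        linarith [hm K i]
      rw [Finset.mem_insert, not_or] at hi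
      linarith [hs (K ∪ S) i s hi.1 hi.2 hs']
  have step2 : ∀ T K S : Finset N, f (K ∪ S ∪ T) + f K ≤ f (K ∪ T) + f (K ∪ S) := by
    intro T K S
    induction T using Finset.induction_on with
    | empty => simp [add_comm]
    | insert t T _ ih =>
      rw [Finset.union_insert, Finset.union_insert]
      have := step S (K ∪ T) t
      rw [Finset.union_right_comm] at this
      linarith
  refine .of_mono_submod h0 mono fun A B => ?_
  have := step2 B (A ∩ B) A
  rw [Finset.union_eq_right.2 Finset.inter_subset_left,
    Finset.union_eq_right.2 Finset.inter_subset_right] at this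
  linarith

/-- Taking unions commutes with `∪` but gives only an inclusion for `∩`; monotonicity of `f` closes
the gap. -/
theorem IsPolymatroid.biUnion {f : Finset N → ℝ} (hf : IsPolymatroid f) (s : M → Finset N) :
    IsPolymatroid fun K : Finset M => f (K.biUnion s) :=
  .of_mono_submod (by simpa using hf.empty)
    (fun A B h => hf.mono (Finset.biUnion_subset_biUnion_of_subset_left _ h)) fun A B => by
      have h1 := hf.submod (A.biUnion s) (B.biUnion s)
      have h2 : f ((A ∩ B).biUnion s) ≤ f (A.biUnion s ∩ B.biUnion s) :=
        hf.mono (Finset.subset_inter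
          (Finset.biUnion_subset_biUnion_of_subset_left _ Finset.inter_subset_left)
          (Finset.biUnion_subset_biUnion_of_subset_left _ Finset.inter_subset_right))
      rw [← Finset.union_biUnion] at h1
      linarith

end Polymatroid

/-! ### Extension by a common information -/

/-- The subset of a four-element set with the given characteristic function. -/
def ofBits (a b c d : Bool) : Finset (Fin 4) :=
  Finset.univ.filter fun i => ![a, b, c, d] i = true

theorem ofBits_union : ∀ a b c d a' b' c' d' : Bool, ofBits a b c d ∪ ofBits a' b' c' d' =
    ofBits (a || a') (b || b') (c || c') (d || d') := by
  decide

theorem ofBits_inter : ∀ a b c d a' b' c' d' : Bool, ofBits a b c d ∩ ofBits a' b' c' d' =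
    ofBits (a && a') (b && b') (c && c') (d && d') := by
  decide

/-- The values of the extension by a common information `w` of `a` and `b`, for given values
`m`, `x`, `y`, `u` at `w`, `cw`, `dw`, `cdw`. -/
def commonInfoVal (P : Bool → Bool → Bool → Bool → ℝ) (m x y u : ℝ) (a b c d w : Bool) : ℝ :=
  if w && !a && !b then
    if c then if d then u else x else if d then y else m
  else P a b c d

set_option maxHeartbeats 4000000 in
/-- A polymatroid satisfying five of the Ingleton inequalities for `A`, `B`, `C`, `D` has an
extension by a common information (the element `4`) of `A` and `B`. -/
theorem IsPolymatroid.exists_commonInfo {N : Type*} [DecidableEq N] {f : Finset N → ℝ}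
    (hf : IsPolymatroid f) (A B C D : Finset N) (i1 : 0 ≤ ingletonExpr f A B C D)
    (i2 : 0 ≤ ingletonExpr f A C B D) (i3 : 0 ≤ ingletonExpr f A D B C)
    (i4 : 0 ≤ ingletonExpr f B C A D) (i5 : 0 ≤ ingletonExpr f B D A C) :
    ∃ q : Finset (Fin 5) → ℝ, IsPolymatroid q ∧ q {4} = mutInfo f A B ∧
      ∀ K : Finset (Fin 5), 4 ∉ K ∨ 0 ∈ K ∨ 1 ∈ K → q K = f (K.biUnion ![A, B, C, D, ∅]) := by
  have hp := hf.biUnion ![A, B, C, D]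
  -- Subsets are coded by bits, so that the elemental inequalities of the extension become finitely
  -- many linear checks.
  set P : Bool → Bool → Bool → Bool → ℝ :=
    fun a b c d => f ((ofBits a b c d).biUnion ![A, B, C, D]) with hPdef
  have sub : ∀ a b c d a' b' c' d' : Bool,
      P (a || a') (b || b') (c || c') (d || d') + P (a && a') (b && b') (c && c') (d && d') ≤
        P a b c d + P a' b' c' d' := by
    intro a b c d a' b' c' d'
    have := hp.submod (ofBits a b c d) (ofBits a' b' c' d')
    rwa [ofBits_union, ofBits_inter] at this
  have P0 : P false false false false = 0 := by
    have : ofBits false false false false = ∅ := by decide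
    simpa [hPdef, this] using hf.empty
  have hbi : ∀ a b c d : Bool, P a b c d = f ((if a then A else ∅) ∪ (if b then B else ∅) ∪
      (if c then C else ∅) ∪ (if d then D else ∅)) := by
    intro a b c d
    simp only [hPdef]
    congr 1
    ext x
    cases a <;> cases b <;> cases c <;> cases d <;> simp [ofBits, Fin.exists_fin_succ]
  have mono : ∀ a b c d a' b' c' d' : Bool, ofBits a b c d ⊆ ofBits a' b' c' d' →
      P a b c d ≤ P a' b' c' d' := fun a b c d a' b' c' d' h => hp.mono h
  simp only [ingletonExpr, mutInfo, condMutInfo, Finset.union_comm, Finset.union_left_comm]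
    at i1 i2 i3 i4 i5 ⊢
  obtain ⟨a, b, c, d, ab, ac, ad, bc, bd, cd, abc, abd, acd, bcd, abcd, ha, hb, hc, hd, hab, hac, had,
    hbc, hbd, hcd, habc, habd, hacd, hbcd, habcd⟩ : ∃ a b c d ab ac ad bc bd cd abc abd acd bcd abcd,
      P true false false false = a ∧
      P false true false false = b ∧
      P false false true false = c ∧
      P false false false true = d ∧
      P true true false false = ab ∧
      P true false true false = ac ∧
      P true false false true = ad ∧
      P false true true false = bc ∧
      P false true false true = bd ∧
      P false false true true = cd ∧
      P true true true false = abc ∧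
      P true true false true = abd ∧
      P true false true true = acd ∧
      P false true true true = bcd ∧
      P true true true true = abcd :=
    ⟨_, _, _, _, _, _, _, _, _, _, _, _, _, _, _, rfl, rfl, rfl, rfl, rfl, rfl, rfl, rfl, rfl, rfl, rfl,
      rfl, rfl, rfl, rfl⟩
  have e_a : f A = a := by
    simp [← ha, hbi]
  have e_b : f B = b := by
    simp [← hb, hbi]
  have e_c : f C = c := by
    simp [← hc, hbi]
  have e_d : f D = d := by
    simp [← hd, hbi]
  have e_ab : f (A ∪ B) = ab := by
    simp [← hab, hbi]
  have e_ac : f (A ∪ C) = ac := by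
    simp [← hac, hbi]
  have e_ad : f (A ∪ D) = ad := by
    simp [← had, hbi]
  have e_bc : f (B ∪ C) = bc := by
    simp [← hbc, hbi]
  have e_bd : f (B ∪ D) = bd := by
    simp [← hbd, hbi]
  have e_cd : f (C ∪ D) = cd := by
    simp [← hcd, hbi]
  have e_abc : f (A ∪ (B ∪ C)) = abc := by
    simp [← habc, hbi, Finset.union_assoc]
  have e_abd : f (A ∪ (B ∪ D)) = abd := by
    simp [← habd, hbi, Finset.union_assoc]
  have e_acd : f (A ∪ (C ∪ D)) = acd := by
    simp [← hacd, hbi, Finset.union_assoc]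
  have e_bcd : f (B ∪ (C ∪ D)) = bcd := by
    simp [← hbcd, hbi, Finset.union_assoc]
  simp only [e_a, e_b, e_c, e_d, e_ab, e_ac, e_ad, e_bc, e_bd, e_cd, e_abc, e_abd, e_acd, e_bcd]
    at i1 i2 i3 i4 i5 ⊢
  have s_ab : ab ≤ a + b := by
    simpa [ha, hb, hab, P0] using sub true false false false false true false false
  have s_ac : ac ≤ a + c := by
    simpa [ha, hc, hac, P0] using sub true false false false false false true false
  have s_ad : ad ≤ a + d := by
    simpa [ha, hd, had, P0] using sub true false false false false false false true
  have s_bc : bc ≤ b + c := by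
    simpa [hb, hc, hbc, P0] using sub false true false false false false true false
  have s_bd : bd ≤ b + d := by
    simpa [hb, hd, hbd, P0] using sub false true false false false false false true
  have s_cd : cd ≤ c + d := by
    simpa [hc, hd, hcd, P0] using sub false false true false false false false true
  have s_ab_c : abc + c ≤ ac + bc := by
    simpa [hac, hbc, habc, hc] using sub true false true false false true true false
  have s_ab_d : abd + d ≤ ad + bd := by
    simpa [had, hbd, habd, hd] using sub true false false true false true false true
  have s_ab_cd : abcd + cd ≤ acd + bcd := by
    simpa [hacd, hbcd, habcd, hcd] using sub true false true true false true true true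
  have s_ac_b : abc + b ≤ ab + bc := by
    simpa [hab, hbc, habc, hb] using sub true true false false false true true false
  have s_ac_d : acd + d ≤ ad + cd := by
    simpa [had, hcd, hacd, hd] using sub true false false true false false true true
  have s_ac_bd : abcd + bd ≤ abd + bcd := by
    simpa [habd, hbcd, habcd, hbd] using sub true true false true false true true true
  have s_ad_b : abd + b ≤ ab + bd := by
    simpa [hab, hbd, habd, hb] using sub true true false false false true false true
  have s_ad_c : acd + c ≤ ac + cd := by
    simpa [hac, hcd, hacd, hc] using sub true false true false false false true true
  have s_ad_bc : abcd + bc ≤ abc + bcd := by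
    simpa [habc, hbcd, habcd, hbc] using sub true true true false false true true true
  have s_bc_a : abc + a ≤ ab + ac := by
    simpa [hab, hac, habc, ha] using sub true true false false true false true false
  have s_bc_d : bcd + d ≤ bd + cd := by
    simpa [hbd, hcd, hbcd, hd] using sub false true false true false false true true
  have s_bc_ad : abcd + ad ≤ abd + acd := by
    simpa [habd, hacd, habcd, had] using sub true true false true true false true true
  have s_bd_a : abd + a ≤ ab + ad := by
    simpa [hab, had, habd, ha] using sub true true false false true false false true
  have s_bd_c : bcd + c ≤ bc + cd := by
    simpa [hbc, hcd, hbcd, hc] using sub false true true false false false true true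
  have s_bd_ac : abcd + ac ≤ abc + acd := by
    simpa [habc, hacd, habcd, hac] using sub true true true false true false true true
  have s_cd_a : acd + a ≤ ac + ad := by
    simpa [hac, had, hacd, ha] using sub true false true false true false false true
  have s_cd_b : bcd + b ≤ bc + bd := by
    simpa [hbc, hbd, hbcd, hb] using sub false true true false false true false true
  have s_cd_ab : abcd + ab ≤ abc + abd := by
    simpa [habc, habd, habcd, hab] using sub true true true false true true false true
  have m_a : bcd ≤ abcd := by
    simpa only [hbcd, habcd] using mono false true true true true true true true (by decide)
  have m_b : acd ≤ abcd := by
    simpa only [hacd, habcd] using mono true false true true true true true true (by decide)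
  have m_c : abd ≤ abcd := by
    simpa only [habd, habcd] using mono true true false true true true true true (by decide)
  have m_d : abc ≤ abcd := by
    simpa only [habc, habcd] using mono true true true false true true true true (by decide)
  obtain ⟨m, hm⟩ : ∃ m, m = a + b - ab := ⟨_, rfl⟩
  obtain ⟨x, y, u, h1, h2, h3, h4, h5, h6, h7, h8, h9, h10, h11, h12, h13, h14, h15, h16, h17, h18,
    h19⟩ := exists_commonInfo_values hm s_ab s_ac s_ad s_bc s_bd s_cd s_ab_c s_ab_d
    s_ab_cd s_ac_b s_ac_d s_ac_bd s_ad_b s_ad_c s_ad_bc s_bc_a s_bc_d s_bc_ad s_bd_a s_bd_c s_bd_ac s_cd_a s_cd_b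
    (by linarith) (by linarith) (by linarith) (by linarith) (by linarith)
  have hQ : ∀ a b c d w, commonInfoVal P m x y u a b c d w = if w && !a && !b then
      if c then if d then u else x else if d then y else m else P a b c d := fun _ _ _ _ _ => rfl
  set Q := commonInfoVal P m x y u
  clear_value Q
  clear i1 i2 i3 i4 i5 hp sub mono hbi
  have Qm0 : ∀ b c d w, Q false b c d w ≤ Q true b c d w := by
    rintro (_ | _) (_ | _) (_ | _) (_ | _) <;>
      simp [hQ, P0, ha, hb, hc, hd, hab, hac, had, hbc, hbd, hcd, habc, habd, hacd, hbcd, habcd] <;>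
      linarith
  have Qm1 : ∀ a c d w, Q a false c d w ≤ Q a true c d w := by
    rintro (_ | _) (_ | _) (_ | _) (_ | _) <;>
      simp [hQ, P0, ha, hb, hc, hd, hab, hac, had, hbc, hbd, hcd, habc, habd, hacd, hbcd, habcd] <;>
      linarith
  have Qm2 : ∀ a b d w, Q a b false d w ≤ Q a b true d w := by
    rintro (_ | _) (_ | _) (_ | _) (_ | _) <;>
      simp [hQ, P0, ha, hb, hc, hd, hab, hac, had, hbc, hbd, hcd, habc, habd, hacd, hbcd, habcd] <;>
      linarith
  have Qm3 : ∀ a b c w, Q a b c false w ≤ Q a b c true w := by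
    rintro (_ | _) (_ | _) (_ | _) (_ | _) <;>
      simp [hQ, P0, ha, hb, hc, hd, hab, hac, had, hbc, hbd, hcd, habc, habd, hacd, hbcd, habcd] <;>
      linarith
  have Qm4 : ∀ a b c d, Q a b c d false ≤ Q a b c d true := by
    rintro (_ | _) (_ | _) (_ | _) (_ | _) <;>
      simp [hQ, P0, ha, hb, hc, hd, hab, hac, had, hbc, hbd, hcd, habc, habd, hacd, hbcd, habcd] <;>
      linarith
  have Qs01 : ∀ c d w, Q true true c d w + Q false false c d w ≤
      Q true false c d w + Q false true c d w := by
    rintro (_ | _) (_ | _) (_ | _) <;>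
      simp [hQ, P0, ha, hb, hc, hd, hab, hac, had, hbc, hbd, hcd, habc, habd, hacd, hbcd, habcd] <;>
      linarith
  have Qs02 : ∀ b d w, Q true b true d w + Q false b false d w ≤
      Q true b false d w + Q false b true d w := by
    rintro (_ | _) (_ | _) (_ | _) <;>
      simp [hQ, P0, ha, hb, hc, hd, hab, hac, had, hbc, hbd, hcd, habc, habd, hacd, hbcd, habcd] <;>
      linarith
  have Qs03 : ∀ b c w, Q true b c true w + Q false b c false w ≤
      Q true b c false w + Q false b c true w := by
    rintro (_ | _) (_ | _) (_ | _) <;>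
      simp [hQ, P0, ha, hb, hc, hd, hab, hac, had, hbc, hbd, hcd, habc, habd, hacd, hbcd, habcd] <;>
      linarith
  have Qs04 : ∀ b c d, Q true b c d true + Q false b c d false ≤
      Q true b c d false + Q false b c d true := by
    rintro (_ | _) (_ | _) (_ | _) <;>
      simp [hQ, P0, ha, hb, hc, hd, hab, hac, had, hbc, hbd, hcd, habc, habd, hacd, hbcd, habcd] <;>
      linarith
  have Qs12 : ∀ a d w, Q a true true d w + Q a false false d w ≤
      Q a true false d w + Q a false true d w := by
    rintro (_ | _) (_ | _) (_ | _) <;>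
      simp [hQ, P0, ha, hb, hc, hd, hab, hac, had, hbc, hbd, hcd, habc, habd, hacd, hbcd, habcd] <;>
      linarith
  have Qs13 : ∀ a c w, Q a true c true w + Q a false c false w ≤
      Q a true c false w + Q a false c true w := by
    rintro (_ | _) (_ | _) (_ | _) <;>
      simp [hQ, P0, ha, hb, hc, hd, hab, hac, had, hbc, hbd, hcd, habc, habd, hacd, hbcd, habcd] <;>
      linarith
  have Qs14 : ∀ a c d, Q a true c d true + Q a false c d false ≤
      Q a true c d false + Q a false c d true := by
    rintro (_ | _) (_ | _) (_ | _) <;>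
      simp [hQ, P0, ha, hb, hc, hd, hab, hac, had, hbc, hbd, hcd, habc, habd, hacd, hbcd, habcd] <;>
      linarith
  have Qs23 : ∀ a b w, Q a b true true w + Q a b false false w ≤
      Q a b true false w + Q a b false true w := by
    rintro (_ | _) (_ | _) (_ | _) <;>
      simp [hQ, P0, ha, hb, hc, hd, hab, hac, had, hbc, hbd, hcd, habc, habd, hacd, hbcd, habcd] <;>
      linarith
  have Qs24 : ∀ a b d, Q a b true d true + Q a b false d false ≤
      Q a b true d false + Q a b false d true := by
    rintro (_ | _) (_ | _) (_ | _) <;>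
      simp [hQ, P0, ha, hb, hc, hd, hab, hac, had, hbc, hbd, hcd, habc, habd, hacd, hbcd, habcd] <;>
      linarith
  have Qs34 : ∀ a b c, Q a b c true true + Q a b c false false ≤
      Q a b c true false + Q a b c false true := by
    rintro (_ | _) (_ | _) (_ | _) <;>
      simp [hQ, P0, ha, hb, hc, hd, hab, hac, had, hbc, hbd, hcd, habc, habd, hacd, hbcd, habcd] <;>
      linarith
  refine ⟨fun K => Q (decide (0 ∈ K)) (decide (1 ∈ K)) (decide (2 ∈ K)) (decide (3 ∈ K))
    (decide (4 ∈ K)), .of_insert ?_ ?_ ?_, ?_, ?_⟩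
  · simp [hQ, P0]
  · intro K i
    by_cases hi : i ∈ K
    · rw [Finset.insert_eq_of_mem hi]
    · fin_cases i <;> simp at hi <;> simp [Finset.mem_insert, hi, Qm0, Qm1, Qm2, Qm3, Qm4]
  · intro K i j hij hi hj
    -- The elemental inequality is symmetric in `i` and `j`, so ten families `Qs` are enough.
    wlog h : i < j generalizing i j
    · rw [Finset.insert_comm, add_comm (Q (decide (0 ∈ insert i K)) _ _ _ _)]
      exact this j i hij.symm hj hi (lt_of_le_of_ne (not_lt.1 h) hij.symm)
    fin_cases i <;> fin_cases j <;> simp at h <;> simp at hi hj <;>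
      simp [Finset.mem_insert, hi, hj, Qs01, Qs02, Qs03, Qs04, Qs12, Qs13, Qs14, Qs23, Qs24, Qs34]
  · simp [hQ, hm]
  · intro K hK
    have : Q (decide (0 ∈ K)) (decide (1 ∈ K)) (decide (2 ∈ K)) (decide (3 ∈ K)) (decide (4 ∈ K)) =
        P (decide (0 ∈ K)) (decide (1 ∈ K)) (decide (2 ∈ K)) (decide (3 ∈ K)) := by
      rw [hQ]
      rcases hK with h | h | h <;> simp [h]
    refine this.trans ?_
    simp only [hPdef]
    refine congrArg f ?_
    ext v
    simp [ofBits, Fin.exists_fin_succ]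

/-! ### Free gluing over a modular lattice -/

section Glue

variable {ι N E : Type*} [Fintype ι] [DecidableEq E]

/-- The summand of `glue` for a member `T` of the lattice. -/
def gluePart (q : ι → Finset E → ℝ) (s : ι → N → Finset E) (r : Finset E → ℝ) (c : ℝ)
    (T : Finset E) (I : Finset N) : ℝ :=
  ∑ i, q i (I.biUnion (s i) ∪ T) - c * r T

/-- The free gluing of the polymatroids `q i` over a common lattice `L` of sets, on which they
agree with a modular function `r`. An element `x` of the new base set is the set `s i x` in the
`i`-th polymatroid. -/
def glue (L : Finset (Finset E)) (hL : L.Nonempty) (q : ι → Finset E → ℝ) (s : ι → N → Finset E)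
    (r : Finset E → ℝ) (c : ℝ) (I : Finset N) : ℝ :=
  L.inf' hL fun T => gluePart q s r c T I

variable {L : Finset (Finset E)} {hL : L.Nonempty} {q : ι → Finset E → ℝ}
  {s : ι → N → Finset E} {r : Finset E → ℝ} {c : ℝ}

theorem glue_le {T : Finset E} (hT : T ∈ L) (I : Finset N) :
    glue L hL q s r c I ≤ gluePart q s r c T I :=
  Finset.inf'_le _ hT

theorem le_glue {I : Finset N} {t : ℝ} (h : ∀ T ∈ L, t ≤ gluePart q s r c T I) :
    t ≤ glue L hL q s r c I :=
  Finset.le_inf' _ _ h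

theorem exists_glue_eq (I : Finset N) : ∃ T ∈ L, glue L hL q s r c I = gluePart q s r c T I :=
  Finset.exists_mem_eq_inf' hL _

/-- Let `T`, `S` be minimizers for `A`, `B`, and test `A ∪ B` with `T ∪ S` and `A ∩ B` with `T ∩ S`.
The terms `q i` are submodular, and the terms `-c * r` cancel exactly because `r` is modular; mere
submodularity of `r` would have the wrong sign. At `∅` the summand is `r T`, since `c` is one less
than the number of parts. -/
theorem isPolymatroid_glue [DecidableEq N] (h0 : ∅ ∈ L) (hsup : ∀ T ∈ L, ∀ S ∈ L, T ∪ S ∈ L)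
    (hinf : ∀ T ∈ L, ∀ S ∈ L, T ∩ S ∈ L) (hq : ∀ i, IsPolymatroid (q i))
    (hqr : ∀ i, ∀ T ∈ L, q i T = r T) (hr : ∀ T ∈ L, 0 ≤ r T) (hr0 : r ∅ = 0)
    (hmod : ∀ T ∈ L, ∀ S ∈ L, r (T ∪ S) + r (T ∩ S) = r T + r S)
    (hc : c + 1 = Fintype.card ι) : IsPolymatroid (glue L hL q s r c) := by
  have hempty : ∀ T ∈ L, gluePart q s r c T ∅ = r T := by
    intro T hT
    simp only [gluePart, Finset.biUnion_empty, Finset.empty_union, hqr _ T hT, Finset.sum_const,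
      Finset.card_univ, nsmul_eq_mul, ← hc]
    ring
  refine .of_mono_submod (le_antisymm ?_ (le_glue fun T hT => ?_)) (fun A B h => ?_) fun A B => ?_
  · exact (glue_le h0 _).trans_eq ((hempty _ h0).trans hr0)
  · exact (hr T hT).trans_eq (hempty T hT).symm
  · refine le_glue fun T hT => (glue_le hT A).trans (sub_le_sub_right ?_ _)
    exact Finset.sum_le_sum fun i _ => (hq i).mono (Finset.union_subset_union_left
      (Finset.biUnion_subset_biUnion_of_subset_left _ h))
  · obtain ⟨T, hT, hA⟩ := exists_glue_eq (hL := hL) (q := q) (s := s) (r := r) (c := c) A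
    obtain ⟨S, hS, hB⟩ := exists_glue_eq (hL := hL) (q := q) (s := s) (r := r) (c := c) B
    have h1 := glue_le (hL := hL) (q := q) (s := s) (r := r) (c := c) (hsup T hT S hS) (A ∪ B)
    have h2 := glue_le (hL := hL) (q := q) (s := s) (r := r) (c := c) (hinf T hT S hS) (A ∩ B)
    have h3 : ∑ i, (q i ((A ∪ B).biUnion (s i) ∪ (T ∪ S)) + q i ((A ∩ B).biUnion (s i) ∪ T ∩ S)) ≤
        ∑ i, (q i (A.biUnion (s i) ∪ T) + q i (B.biUnion (s i) ∪ S)) := by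
      refine Finset.sum_le_sum fun i _ => ?_
      have h4 := (hq i).submod (A.biUnion (s i) ∪ T) (B.biUnion (s i) ∪ S)
      rw [Finset.union_union_union_comm, ← Finset.union_biUnion] at h4
      refine (add_le_add_right ((hq i).mono ?_) _).trans h4
      intro x
      simp only [Finset.mem_union, Finset.mem_inter, Finset.mem_biUnion]
      rintro (⟨y, ⟨hyA, hyB⟩, hx⟩ | ⟨hx, hx'⟩)
      · exact ⟨.inl ⟨y, hyA, hx⟩, .inl ⟨y, hyB, hx⟩⟩
      · exact ⟨.inr hx, .inr hx'⟩
    rw [Finset.sum_add_distrib, Finset.sum_add_distrib] at h3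
    have h5 := hmod T hT S hS
    rw [hA, hB]
    simp only [gluePart] at h1 h2 ⊢
    linear_combination h1 + h2 + h3 + (-c) * h5

/-- Adding a closed set of the lattice does not change the part it already spans. -/
theorem glue_eq_of_subset (hq : ∀ i, IsPolymatroid (q i)) (hqr : ∀ i, ∀ T ∈ L, q i T = r T)
    (hc : c + 1 = Fintype.card ι) (i : ι) {I : Finset N} {T : Finset E} (hT : T ∈ L)
    (h : ∀ j ≠ i, I.biUnion (s j) ⊆ T)
    (hi : q i (I.biUnion (s i) ∪ T) = q i (I.biUnion (s i))) :
    glue L hL q s r c I = q i (I.biUnion (s i)) := by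
  classical
  -- With `c` the number of parts other than `i`, the summand is the rank in part `i` plus the
  -- conditional ranks over `T` in the others. These are non-negative, and vanish for a `T`
  -- containing the traces of `I` there.
  have key : ∀ T, gluePart q s r c T I =
      q i (I.biUnion (s i) ∪ T) + ∑ j ∈ Finset.univ.erase i, (q j (I.biUnion (s j) ∪ T) - r T) := by
    intro T
    have hcard : ((Finset.univ.erase i).card : ℝ) = c := by
      rw [Finset.card_erase_of_mem (Finset.mem_univ i), Finset.card_univ,
        Nat.cast_sub (Fintype.card_pos_iff.2 ⟨i⟩), ← hc]
      simp
    rw [gluePart, ← Finset.add_sum_erase _ _ (Finset.mem_univ i), Finset.sum_sub_distrib,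
      Finset.sum_const, nsmul_eq_mul, hcard]
    ring
  refine le_antisymm ((glue_le hT I).trans_eq ?_) (le_glue fun S hS => ?_)
  · rw [key, hi, Finset.sum_eq_zero, add_zero]
    intro j hj
    rw [Finset.union_eq_right.2 (h j (Finset.ne_of_mem_erase hj)), hqr j T hT, sub_self]
  · rw [key]
    refine le_add_of_le_of_nonneg ((hq i).mono Finset.subset_union_left)
      (Finset.sum_nonneg fun j _ => ?_)
    rw [← hqr j S hS]
    exact sub_nonneg.2 ((hq j).mono Finset.subset_union_right)

/-- A set spanning the whole lattice splits freely. -/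
theorem glue_eq_sum {I : Finset N} {T : Finset E} (hT : T ∈ L) (hr : ∀ S ∈ L, r S ≤ r T)
    (hc : 0 ≤ c) (h : ∀ S ∈ L, ∀ i, q i (I.biUnion (s i) ∪ S) = q i (I.biUnion (s i))) :
    glue L hL q s r c I = ∑ i, q i (I.biUnion (s i)) - c * r T := by
  -- When every `S` in `L` is already spanned, only `-c * r S` varies, and `T` makes it least.
  refine le_antisymm ((glue_le hT I).trans_eq ?_) (le_glue fun S hS => ?_)
  · simp only [gluePart, h T hT]
  · simp only [gluePart, h S hS]
    exact sub_le_sub_left (mul_le_mul_of_nonneg_left (hr S hS) hc) _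

end Glue

/-! ### Construction of the `n`-copy -/

/-- The sets spanned by parts of `a`, `b` and their common information `4`. -/
def coreLattice : Finset (Finset (Fin 5)) := {∅, {4}, {0, 4}, {1, 4}, {0, 1, 4}}

/-- The elements `a`, `b`, `c`, `d` or `a`, `b`, `z` in a part of the gluing. -/
def partBase {n : ℕ} : Option (Fin n) → Fin 5 → Finset Base
  | none => ![{Base.a}, {Base.b}, {Base.z}, ∅, ∅]
  | some _ => ![{Base.a}, {Base.b}, {Base.c}, {Base.d}, ∅]

/-- The elements of `CopyBase n` in a part of the gluing. -/
def partSet {n : ℕ} : Option (Fin n) → CopyBase n → Finset (Fin 5)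
  | _, CopyBase.a => {0}
  | _, CopyBase.b => {1}
  | none, CopyBase.z => {2}
  | some _, CopyBase.z => ∅
  | none, CopyBase.c _ => ∅
  | none, CopyBase.d _ => ∅
  | some i, CopyBase.c j => if j = i then {2} else ∅
  | some i, CopyBase.d j => if j = i then {3} else ∅

theorem partSet_a {n : ℕ} (k : Option (Fin n)) : partSet k CopyBase.a = {0} := by
  cases k <;> rfl

theorem partSet_b {n : ℕ} (k : Option (Fin n)) : partSet k CopyBase.b = {1} := by
  cases k <;> rfl

theorem partBase_zero {n : ℕ} (k : Option (Fin n)) : partBase k 0 = {Base.a} := by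
  cases k <;> rfl

theorem partBase_one {n : ℕ} (k : Option (Fin n)) : partBase k 1 = {Base.b} := by
  cases k <;> rfl

theorem partBase_four {n : ℕ} (k : Option (Fin n)) : partBase k 4 = ∅ := by
  cases k <;> rfl

theorem four_notMem_partSet {n : ℕ} (k : Option (Fin n)) (x : CopyBase n) : 4 ∉ partSet k x := by
  rcases k with _ | k <;> rcases x with _ | _ | _ | x | x <;> simp [partSet] <;> split_ifs <;> simp

theorem biUnion_block_partSet {n : ℕ} {I : Finset (Option (Fin n))} {k : Option (Fin n)}
    (hk : k ∉ I) : (I.biUnion block).biUnion (partSet k) = ∅ := by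
  rw [← Finset.subset_empty, Finset.biUnion_subset]
  intro x hx
  obtain ⟨j, hj, hx⟩ := Finset.mem_biUnion.1 hx
  have hjk : j ≠ k := fun h => hk (h ▸ hj)
  rcases k with _ | k <;> rcases j with _ | j <;> simp [block] at hx hjk <;>
    rcases hx with rfl | rfl <;> simp [partSet, hjk]

/-- The span of `A ∩ {a, b}` in `coreLattice`. -/
def coreClosure (A : Finset Base) : Finset (Fin 5) :=
  (if Base.a ∈ A then {0, 4} else ∅) ∪ (if Base.b ∈ A then {1, 4} else ∅)

theorem coreClosure_mem (A : Finset Base) : coreClosure A ∈ coreLattice := by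
  unfold coreClosure
  split_ifs <;> decide

/-- Lets the part `abz` be treated as a quadruple with an empty fourth set, for which Ingleton is a
Shannon consequence. Both parts of the gluing then come from the same extension result. -/
theorem IsPolymatroid.ingleton_empty {N : Type*} [DecidableEq N] {f : Finset N → ℝ}
    (hf : IsPolymatroid f) (A B C : Finset N) :
    0 ≤ ingletonExpr f A B C ∅ ∧ 0 ≤ ingletonExpr f A ∅ B C := by
  have h1 := hf.condMutInfo_nonneg A B C
  have h2 := hf.mutInfo_nonneg B C
  simp only [ingletonExpr, condMutInfo, mutInfo, Finset.union_empty, Finset.empty_union,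
    hf.empty] at *
  constructor <;> linarith

/-- Every polymatroid satisfying the Ingleton inequalities on `abcd` has `n`-copies. -/
theorem hasNCopy_of_isCentral {f : Finset Base → ℝ} (hf : IsPolymatroid f) (hc : IsCentral f)
    (n : ℕ) : HasNCopy n f := by
  have hex : ∀ k : Option (Fin n), ∃ q : Finset (Fin 5) → ℝ, IsPolymatroid q ∧
      q {4} = mutInfo f {Base.a} {Base.b} ∧
      ∀ K : Finset (Fin 5), 4 ∉ K ∨ 0 ∈ K ∨ 1 ∈ K → q K = f (K.biUnion (partBase k)) := by
    rintro (_ | k)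
    · exact hf.exists_commonInfo _ _ _ _ (hf.ingleton_empty _ _ _).1 (hf.ingleton_empty _ _ _).1
        (hf.ingleton_empty _ _ _).2 (hf.ingleton_empty _ _ _).1 (hf.ingleton_empty _ _ _).2
    · exact hf.exists_commonInfo _ _ _ _ hc.1 hc.2.1 hc.2.2.1 hc.2.2.2.1 hc.2.2.2.2.1
  choose q hq hq4 hqf using hex
  set m := mutInfo f {Base.a} {Base.b} with hm
  -- An additive function is modular; the weights are the values of `a` and `b` conditioned on `w`,
  -- and of `w`. Those at `2` and `3` are irrelevant, as no lattice member contains these points.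
  set r : Finset (Fin 5) → ℝ := fun T => ∑ x ∈ T, ![f {Base.a} - m, f {Base.b} - m, 0, 0, m] x
    with hr
  have hqr : ∀ k, ∀ T ∈ coreLattice, q k T = r T := by
    intro k T hT
    simp only [coreLattice, Finset.mem_insert, Finset.mem_singleton] at hT
    rcases hT with rfl | rfl | rfl | rfl | rfl
    · simpa [hr] using (hq k).empty
    · simp [hr, hq4]
    · rw [hqf k _ (by decide)]
      simp [hr, Finset.biUnion_insert, partBase_zero, partBase_four]
    · rw [hqf k _ (by decide)]
      simp [hr, Finset.biUnion_insert, partBase_one, partBase_four]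
    · rw [hqf k _ (by decide)]
      simp [hr, hm, mutInfo, Finset.biUnion_insert, partBase_zero, partBase_one, partBase_four]
      ring
  have hmod : ∀ T ∈ coreLattice, ∀ S ∈ coreLattice, r (T ∪ S) + r (T ∩ S) = r T + r S :=
    fun T _ S _ => Finset.sum_union_inter
  have hcard : (n : ℝ) + 1 = Fintype.card (Option (Fin n)) := by simp
  have hr0 : ∀ T ∈ coreLattice, 0 ≤ r T := fun T hT => by
    rw [← hqr none T hT, ← (hq none).empty]
    exact (hq none).mono (Finset.empty_subset _)
  have hL : coreLattice.Nonempty := ⟨∅, by decide⟩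
  have span : ∀ k (W S : Finset (Fin 5)), 0 ∈ W ∨ 1 ∈ W → S ⊆ insert 4 W → q k (W ∪ S) = q k W := by
    intro k W S hW hS
    rw [hqf k W (.inr hW), hqf k (W ∪ S) (.inr (hW.imp (Finset.mem_union_left _)
      (Finset.mem_union_left _)))]
    congr 1
    rw [Finset.union_biUnion, Finset.union_eq_left]
    refine (Finset.biUnion_subset_biUnion_of_subset_left _ hS).trans ?_
    simp [Finset.biUnion_insert, partBase_four]
  -- The other parts see at most `a` and `b` from `A`; `coreClosure A` contains these and is spanned
  -- by `A` in part `k`.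
  have restr : ∀ (i : Fin n) (k : Option (Fin n)) (A : Finset Base),
      (∀ x ∈ A, (partSet k (copyMap i x)).biUnion (partBase k) = {x}) →
      (∀ j ≠ k, ∀ x ∈ A, partSet j (copyMap i x) ⊆ coreClosure A) →
      glue coreLattice hL q partSet r n (A.image (copyMap i)) = f A := by
    intro i k A h1 h2
    rw [glue_eq_of_subset hq hqr hcard k (coreClosure_mem A)]
    · rw [hqf]
      · rw [Finset.image_biUnion, Finset.biUnion_biUnion, Finset.biUnion_congr rfl h1,
          Finset.biUnion_singleton_eq_self]
      · left
        simp [four_notMem_partSet]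
    · intro j hj
      rw [Finset.image_biUnion]
      exact Finset.biUnion_subset.2 (h2 j hj)
    · have ha : Base.a ∈ A → 0 ∈ (A.image (copyMap i)).biUnion (partSet k) := fun h =>
        Finset.mem_biUnion.2 ⟨_, Finset.mem_image_of_mem _ h, by simp [copyMap, partSet_a]⟩
      have hb : Base.b ∈ A → 1 ∈ (A.image (copyMap i)).biUnion (partSet k) := fun h =>
        Finset.mem_biUnion.2 ⟨_, Finset.mem_image_of_mem _ h, by simp [copyMap, partSet_b]⟩
      by_cases hA : Base.a ∈ A ∨ Base.b ∈ A
      · refine span _ _ _ (hA.imp ha hb) ?_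
        unfold coreClosure
        split_ifs <;> simp_all [Finset.insert_subset_iff]
      · rw [not_or] at hA
        simp [coreClosure, hA]
  refine ⟨glue coreLattice hL q partSet r n, ?_, ?_, ?_, ?_⟩
  · exact isPolymatroid_glue (by decide) (by decide) (by decide) hq hqr hr0 (by simp [hr]) hmod hcard
  · intro i A hA
    refine restr i none A (fun x hx => ?_) fun j hj x hx => ?_
    · have := hA hx
      cases x <;> simp [abz] at this <;> simp [copyMap, partSet, partBase]
    · obtain ⟨j, rfl⟩ := Option.ne_none_iff_exists'.1 hj
      have := hA hx
      cases x <;> simp [abz] at this <;> simp [copyMap, partSet, coreClosure, hx]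
  · intro i A hA
    refine restr i (some i) A (fun x hx => ?_) fun j hj x hx => ?_
    · have := hA hx
      cases x <;> simp [abcd] at this <;> simp [copyMap, partSet, partBase]
    · have := hA hx
      rcases j with _ | j
      · cases x <;> simp [abcd] at this <;> simp [copyMap, partSet, coreClosure, hx]
      · have hij : i ≠ j := fun h => hj (h ▸ rfl)
        cases x <;> simp [abcd] at this <;> simp [copyMap, partSet, coreClosure, hx, hij]
  · intro I J hIJ
    have hab : ∀ k : Option (Fin n), ({CopyBase.a, CopyBase.b} : Finset _).biUnion (partSet k) =
        {0, 1} := fun k => by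
      rw [Finset.biUnion_insert, Finset.singleton_biUnion, partSet_a, partSet_b]
      rfl
    -- In the presence of `a` and `b` every lattice member is spanned in every part, so the glued
    -- rank splits.
    have key : ∀ X : Finset (CopyBase n),
        glue coreLattice hL q partSet r n (X ∪ {CopyBase.a, CopyBase.b}) =
          ∑ k, q k (X.biUnion (partSet k) ∪ {0, 1}) - n * r {0, 1, 4} := by
      intro X
      have hX : ∀ k : Option (Fin n), (X ∪ {CopyBase.a, CopyBase.b}).biUnion (partSet k) =
        X.biUnion (partSet k) ∪ {0, 1} := fun k => by rw [Finset.union_biUnion, hab]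
      have hsub : ∀ S ∈ coreLattice, S ⊆ {0, 1, 4} := by decide
      rw [glue_eq_sum (T := {0, 1, 4}) (by decide) _ n.cast_nonneg]
      · simp only [hX]
      · intro S hS k
        rw [hX]
        refine span _ _ _ (by simp) ((hsub S hS).trans ?_)
        intro x
        simp
        tauto
      · intro S hS
        rw [← hqr none S hS, ← hqr none _ (by decide)]
        exact (hq none).mono (hsub S hS)
    have key0 := key ∅
    rw [Finset.empty_union] at key0
    rw [condMutInfo, key, key, key, key0]
    -- Termwise: block `k` is missing from `I` or from `J`, and that union then has no trace in part
    -- `k`.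
    have : ∑ k, (q k ((I.biUnion block).biUnion (partSet k) ∪ {0, 1}) +
          q k ((J.biUnion block).biUnion (partSet k) ∪ {0, 1})) =
        ∑ k, (q k ((I.biUnion block ∪ J.biUnion block).biUnion (partSet k) ∪ {0, 1}) +
          q k ((∅ : Finset (CopyBase n)).biUnion (partSet k) ∪ {0, 1})) := by
      refine Finset.sum_congr rfl fun k _ => ?_
      rw [Finset.union_biUnion, Finset.biUnion_empty]
      by_cases hk : k ∈ I
      · rw [biUnion_block_partSet (Finset.disjoint_left.1 hIJ hk), Finset.union_empty]
      · rw [biUnion_block_partSet hk, Finset.empty_union, Finset.empty_union, add_comm]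
    rw [Finset.sum_add_distrib, Finset.sum_add_distrib] at this
    linarith

/-! ### Linear polymatroids satisfy Ingleton -/

/-- Ingleton's inequality for the dimensions of subspaces. -/
theorem ingleton_finrank {F V : Type*} [Field F] [AddCommGroup V] [Module F V]
    [FiniteDimensional F V] (A B C D : Submodule F V) :
    (Module.finrank F A + Module.finrank F B + Module.finrank F (A ⊔ B ⊔ C : Submodule F V) +
      Module.finrank F (A ⊔ B ⊔ D : Submodule F V) + Module.finrank F (C ⊔ D : Submodule F V) : ℝ) ≤
    Module.finrank F (A ⊔ B : Submodule F V) + Module.finrank F (A ⊔ C : Submodule F V) +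
      Module.finrank F (B ⊔ C : Submodule F V) + Module.finrank F (A ⊔ D : Submodule F V) +
      Module.finrank F (B ⊔ D : Submodule F V) := by
  norm_cast
  -- For subspaces `A ⊓ B` is a genuine common information; the bound follows from submodularity for
  -- `A ⊓ B ⊔ C` and `A ⊓ B ⊔ D`.
  have h1 := Submodule.finrank_sup_add_finrank_inf_eq A B
  have h2 := Submodule.finrank_sup_add_finrank_inf_eq (A ⊔ C) (B ⊔ C)
  have h3 := Submodule.finrank_sup_add_finrank_inf_eq (A ⊔ D) (B ⊔ D)
  have h4 := Submodule.finrank_sup_add_finrank_inf_eq (A ⊓ B ⊔ C) (A ⊓ B ⊔ D)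
  have h5 : Module.finrank F (A ⊓ B ⊔ C : Submodule F V) ≤
      Module.finrank F ((A ⊔ C) ⊓ (B ⊔ C) : Submodule F V) :=
    Submodule.finrank_mono (le_inf (sup_le_sup_right inf_le_left _) (sup_le_sup_right inf_le_right _))
  have h6 : Module.finrank F (A ⊓ B ⊔ D : Submodule F V) ≤
      Module.finrank F ((A ⊔ D) ⊓ (B ⊔ D) : Submodule F V) :=
    Submodule.finrank_mono (le_inf (sup_le_sup_right inf_le_left _) (sup_le_sup_right inf_le_right _))
  have h7 : Module.finrank F (C ⊔ D : Submodule F V) ≤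
      Module.finrank F (A ⊓ B ⊔ C ⊔ (A ⊓ B ⊔ D) : Submodule F V) :=
    Submodule.finrank_mono (sup_le_sup le_sup_right le_sup_right)
  have h8 : Module.finrank F (A ⊓ B : Submodule F V) ≤
      Module.finrank F ((A ⊓ B ⊔ C) ⊓ (A ⊓ B ⊔ D) : Submodule F V) :=
    Submodule.finrank_mono (le_inf le_sup_left le_sup_left)
  rw [← sup_sup_distrib_right] at h2 h3
  omega

theorem IsRepresentable.ingletonExpr_nonneg {N : Type*} [DecidableEq N] {F : Type u} [Field F]
    {f : Finset N → ℝ} (hf : IsRepresentable F f) (A B C D : Finset N) :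
    0 ≤ ingletonExpr f A B C D := by
  obtain ⟨V, _, _, _, W, hW⟩ := hf
  obtain ⟨r, hr⟩ : ∃ r : Submodule F V → ℝ, ∀ S, r S = Module.finrank F S := ⟨_, fun _ => rfl⟩
  have := ingleton_finrank (⨆ i ∈ A, W i) (⨆ i ∈ B, W i) (⨆ i ∈ C, W i) (⨆ i ∈ D, W i)
  simp only [← hr] at this hW
  simp only [ingletonExpr, mutInfo, condMutInfo, hW, Finset.iSup_union]
  linarith

theorem IsLinear.ingletonExpr_nonneg {N : Type*} [DecidableEq N] {f : Finset N → ℝ}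
    (hf : IsLinear.{u} f) (A B C D : Finset N) : 0 ≤ ingletonExpr f A B C D := by
  obtain ⟨F, _, hf⟩ := hf
  -- The inequality is closed and stable under non-negative scaling, so it passes from representable
  -- to linear functions.
  have hcl : IsClosed {g : Finset N → ℝ | 0 ≤ ingletonExpr g A B C D} := by
    refine isClosed_le continuous_const ?_
    simp only [ingletonExpr, mutInfo, condMutInfo]
    fun_prop
  refine closure_minimal ?_ hcl hf
  rintro g ⟨t, h, ht, hh, rfl⟩
  have : ingletonExpr (t • h) A B C D = t * ingletonExpr h A B C D := by
    simp only [ingletonExpr, mutInfo, condMutInfo, Pi.smul_apply, smul_eq_mul]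
    ring
  rw [Set.mem_ofPred_eq, this]
  exact mul_nonneg ht (hh.ingletonExpr_nonneg A B C D)

theorem isCentral_of_isLinear {f : Finset Base → ℝ} (hf : IsLinear.{u} (restrict f abcd)) :
    IsCentral f := by
  have h : ∀ x y v w : {x // x ∈ abcd}, 0 ≤ ingletonExpr f {x.1} {y.1} {v.1} {w.1} := by
    intro x y v w
    have := hf.ingletonExpr_nonneg {x} {y} {v} {w}
    simpa only [ingletonExpr, mutInfo, condMutInfo, restrict, Finset.map_union,
      Finset.map_singleton, Function.Embedding.coe_subtype] using this
  exact ⟨h ⟨.a, by decide⟩ ⟨.b, by decide⟩ ⟨.c, by decide⟩ ⟨.d, by decide⟩,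
    h ⟨.a, by decide⟩ ⟨.c, by decide⟩ ⟨.b, by decide⟩ ⟨.d, by decide⟩,
    h ⟨.a, by decide⟩ ⟨.d, by decide⟩ ⟨.b, by decide⟩ ⟨.c, by decide⟩,
    h ⟨.b, by decide⟩ ⟨.c, by decide⟩ ⟨.a, by decide⟩ ⟨.d, by decide⟩,
    h ⟨.b, by decide⟩ ⟨.d, by decide⟩ ⟨.a, by decide⟩ ⟨.c, by decide⟩,
    h ⟨.c, by decide⟩ ⟨.d, by decide⟩ ⟨.a, by decide⟩ ⟨.b, by decide⟩⟩

/-! ### Projection to the 19 coordinates -/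

theorem extend_proj {f : Finset Base → ℝ} (hf : f ∅ = 0) {A : Finset Base}
    (hA : A ⊆ abcd ∨ A ⊆ abz) : extend (proj f) A = f A := by
  unfold extend
  split_ifs with h
  · rfl
  · rw [Finset.not_nonempty_iff_eq_empty.1 fun h' => h ⟨h', hA⟩, hf]

theorem proj_extend (x : Coord → ℝ) : proj (extend x) = x := by
  funext A
  simp [proj, extend, A.2]

theorem isCentral_congr {f g : Finset Base → ℝ} (h : ∀ A ⊆ abcd, f A = g A) :
    IsCentral f ↔ IsCentral g := by
  simp only [IsCentral, ingletonExpr, mutInfo, condMutInfo]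
  repeat rw [h _ (by decide)]

theorem HasNCopy.congr {n : ℕ} {f g : Finset Base → ℝ} (hf : HasNCopy n f)
    (h : ∀ A, A ⊆ abcd ∨ A ⊆ abz → f A = g A) : HasNCopy n g := by
  obtain ⟨p, hp⟩ := hf
  exact ⟨p, hp.polymatroid, fun i A hA => (hp.restr_abz i A hA).trans (h A (.inr hA)),
    fun i A hA => (hp.restr_abcd i A hA).trans (h A (.inl hA)), hp.indep⟩

/-- A function with an `n`-copy agrees with a polymatroid on the subsets of `abcd` and `abz`. -/
theorem HasNCopy.exists_isPolymatroid {n : ℕ} (hn : 1 ≤ n) {f : Finset Base → ℝ}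
    (hf : HasNCopy n f) :
    ∃ g, IsPolymatroid g ∧ ∀ A, A ⊆ abcd ∨ A ⊆ abz → g A = f A := by
  obtain ⟨p, hp⟩ := hf
  -- Pull the copy back along `copyMap 0`; `1 ≤ n` supplies the index.
  refine ⟨_, hp.polymatroid.biUnion fun x => {copyMap ⟨0, hn⟩ x}, fun A hA => ?_⟩
  simp only [Finset.biUnion_singleton]
  exact hA.elim (hp.restr_abcd _ A) (hp.restr_abz _ A)

/-- `extend x` need not be a polymatroid, being `0` off the coordinates; the required polymatroid is
pulled back from the copy. Conversely, both having an `n`-copy and centrality depend only on the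
coordinates. -/
theorem central_qStar_eq {n : ℕ} (hn : 1 ≤ n) :
    {x | x ∈ QStar n ∧ IsCentral (extend x)} = proj '' {f | IsPolymatroid f ∧ IsCentral f} := by
  ext x
  constructor
  · rintro ⟨hx, hc⟩
    obtain ⟨g, hg, h⟩ := HasNCopy.exists_isPolymatroid hn hx
    refine ⟨g, ⟨hg, (isCentral_congr fun A hA => h A (.inl hA)).2 hc⟩, ?_⟩
    rw [← proj_extend x]
    funext A
    exact h A.1 A.2.2
  · rintro ⟨f, ⟨hf, hc⟩, rfl⟩
    have h : ∀ A, A ⊆ abcd ∨ A ⊆ abz → f A = extend (proj f) A := fun A hA =>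
      (extend_proj hf.empty hA).symm
    exact ⟨(hasNCopy_of_isCentral hf hc n).congr h,
      (isCentral_congr fun A hA => h A (.inl hA)).1 hc⟩

end CopyLemma

theorem mainTheorem7 :
    -- a polymatroid whose restriction to `abcd` is linear has `n`-copies
    (∀ f : Finset CopyLemma.Base → ℝ, CopyLemma.IsPolymatroid f →
      CopyLemma.IsLinear.{u} (CopyLemma.restrict f CopyLemma.abcd) →
      ∀ n : ℕ, 1 ≤ n → CopyLemma.HasNCopy n f) ∧
    -- so does every polymatroid in the central part
    (∀ f : Finset CopyLemma.Base → ℝ, CopyLemma.IsPolymatroid f → CopyLemma.IsCentral f →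
      ∀ n : ℕ, 1 ≤ n → CopyLemma.HasNCopy n f) ∧
    -- the central part of `Q*` is cut out by the Shannon and the Ingleton inequalities
    (∀ n : ℕ, 1 ≤ n →
      {x | x ∈ CopyLemma.QStar n ∧ CopyLemma.IsCentral (CopyLemma.extend x)} =
        CopyLemma.proj '' {f | CopyLemma.IsPolymatroid f ∧ CopyLemma.IsCentral f}) ∧
    -- no new linear inequality from the central part of the cone of polymatroids with `n`-copy
    (∀ n : ℕ, 1 ≤ n → ∀ l : (Finset CopyLemma.Base → ℝ) →ₗ[ℝ] ℝ,
      (∀ f ∈ CopyLemma.copyCone n, CopyLemma.IsCentral f → 0 ≤ l f) →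
      ∀ f, CopyLemma.IsPolymatroid f → CopyLemma.IsCentral f → 0 ≤ l f) ∧
    -- no new linear inequality from the central part of `Q*`
    (∀ n : ℕ, 1 ≤ n → ∀ l : (CopyLemma.Coord → ℝ) →ₗ[ℝ] ℝ,
      (∀ x ∈ CopyLemma.QStar n, CopyLemma.IsCentral (CopyLemma.extend x) → 0 ≤ l x) →
      ∀ f, CopyLemma.IsPolymatroid f → CopyLemma.IsCentral f → 0 ≤ l (CopyLemma.proj f)) := by
  refine ⟨fun f hf hl n _ => CopyLemma.hasNCopy_of_isCentral hf
      (CopyLemma.isCentral_of_isLinear hl) n,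
    fun f hf hc n _ => CopyLemma.hasNCopy_of_isCentral hf hc n,
    fun n hn => CopyLemma.central_qStar_eq hn,
    fun n _ l h f hf hc => h f ⟨hf, CopyLemma.hasNCopy_of_isCentral hf hc n⟩ hc,
    fun n hn l h f hf hc => ?_⟩
  have hx := (CopyLemma.central_qStar_eq hn).symm.subset ⟨f, ⟨hf, hc⟩, rfl⟩
  exact h _ hx.1 hx.2
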